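/- **Setting.** A *network* is a finite directed acyclic multigraph with finitely many distinguished *sources*, which have no incoming edges and generate one process each, and finitely many *terminals*. A $(k,n)$ *network code* over an alphabet $A$ assigns to every edge $e$ an edge function with values in $A^n$, whose argument is the message in $A^k$ of $\mathrm{tail}(e)$ if $\mathrm{tail}(e)$ is a source, and the tuple of blocks in $A^n$ carried by the edges entering $\mathrm{tail}(e)$ otherwise; and to every terminal a decoding function from the tuple of blocks on its incoming edges to $A^k$. Over a field $F=A$ the code is *linear* if all edge and decoding functions are $F$-linear. A *sum-network* is a network in which every terminal demands the sum of the messages of all sources. It is *solvable* over an abelian group $A$ if some $(1,1)$ code over $A$ satisfies all demands, and *$k$-length vector linear solvable* over $F$ if some linear $(k,k)$ code over $F$ does. In a *Type IA* network each terminal demands the message of one given source. **Construction $C_2$.** Let $\mathcal N$ be a Type IA network with sources $w_1,\dots,w_m$ and terminals $z^i_j$ ($1\le i\le m$, $1\le j\le n_i$), where $z^i_j$ demands the message of $w_i$. The sum-network $C_2(\mathcal N)$ consists of $\mathcal N$ (whose sources and terminals lose these roles), of sources $s_1,\dots,s_{m+1}$, of terminals $t_i$ and $t^i_j$, of further vertices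 $u_i,v_i$ ($1\le i\le m$), and of the edges $(s_i,w_i)$, $(s_{m+1},u_i)$, $(s_i,t_i)$, $(u_i,v_i)$, $(v_i,t_i)$ for all $i$; $(s_i,u_j)$ for all $i\neq j$ in $\{1,\dots,m\}$; and $(v_i,t^i_j)$, $(z^i_j,t^i_j)$ for all $i,j$. **The Dougherty–Freiling–Zeger network $\mathcal D$.** This is the Type IA network with five sources, generating $a,b,c,d,e$; with twelve bottleneck edges $q$, each from a vertex $\mathrm{in}(q)$ to a vertex $\mathrm{out}(q)$; and with ten terminals. Each $\mathrm{in}(q)$ has one incoming edge from each of the following (a message stands for its source, a bottleneck edge $q'$ for $\mathrm{out}(q')$): $$w:\{a,b\},\quad y:\{b,c\},\quad x:\{w,c\},\quad z:\{w,y\},$$ $$p:\{a,b,c\},\quad p_{ab}:\{a,b\},\quad p_{ac}:\{a,c\},\quad p_{bc}:\{b,c\},$$ $$q:\{c,d,e\},\quad q_{cd}:\{c,d\},\quad q_{ce}:\{c,e\},\quad q_{de}:\{d,e\}.$$ The terminals, given in the same way by what they have an incoming edge from and what they demand, are $$\{a,z\}\to c,\quad \{x,z\}\to b,\quad \{x,y\}\to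 a,\quad \{p,p_{ab}\}\to c,\quad \{p,p_{ac}\}\to b,\quad \{p,p_{bc}\}\to a,$$ $$\{q,q_{de}\}\to c,\quad \{q,q_{cd}\}\to e,\quad \{q,q_{ce}\}\to d,\quad \{p_{ab},p_{ac},p_{bc},q_{cd},q_{ce},q_{de}\}\to c.$$ **Theorem.** The sum-network $C_2(\mathcal D)$ is solvable over the field $\mathbb F_4$, but it is not $k$-length vector linear solvable over $F$ for any finite field $F$ and any $k\ge 1$. In particular, there is a sum-network, with the sum defined over a finite field, that is solvable but has no linear solution over any finite field for any vector dimension. -/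

import Mathlib

/-- A finite directed acyclic multigraph with vertices `V` and edges `E`, together with a family of
sources indexed by `S`, each generating one process, and a family of terminals indexed by `T`.
Sources have no incoming edge. -/
structure Network (V E S T : Type) where
  tail : E → V
  head : E → V
  src : S → V
  term : T → V
  finite_vertex : Finite V
  finite_edge : Finite E
  src_injective : Function.Injective src
  term_injective : Function.Injective term
  head_ne_src : ∀ e s, head e ≠ src s
  acyclic : ∀ v, ¬ Relation.TransGen (fun x y => ∃ e, tail e = x ∧ head e = y) v v

namespace Network

variable {V E S T : Type}

/-- A `(k, n)` fractional network code over the alphabet `A`: every edge has an edge function whose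
arguments are the message blocks (in `A ^ k`) generated at its tail and the blocks (in `A ^ n`)
carried by the edges entering its tail, and every terminal has a decoding function whose arguments
are the blocks carried by its incoming edges. If the tail of an edge is a source, its edge function
is thus a function of the message of that source only, since nothing enters a source;
otherwise it is a function of the incoming blocks only. -/
structure Code (N : Network V E S T) (A : Type*) (k n : ℕ) where
  edge : ∀ e : E, ({s : S // N.src s = N.tail e} → Fin k → A) →
    ({e' : E // N.head e' = N.tail e} → Fin n → A) → Fin n → A
  decode : ∀ t : T, ({e : E // N.head e = N.term t} → Fin n → A) → Fin k → A

/-- When the sources emit the message blocks `X`, the blocks carried by the edges are `Y`. -/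
def Code.Carries {N : Network V E S T} {A : Type*} {k n : ℕ} (C : N.Code A k n)
    (X : S → Fin k → A) (Y : E → Fin n → A) : Prop :=
  ∀ e, Y e = C.edge e (fun s => X s.1) (fun e' => Y e'.1)

/-- All edge functions and all decoding functions are linear over the field `F`. -/
def Code.IsLinear {N : Network V E S T} {F : Type*} [Field F] {k n : ℕ}
    (C : N.Code F k n) : Prop :=
  (∀ e, IsLinearMap F (fun p : ({s : S // N.src s = N.tail e} → Fin k → F) ×
      ({e' : E // N.head e' = N.tail e} → Fin n → F) => C.edge e p.1 p.2)) ∧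
  ∀ t, IsLinearMap F (C.decode t)

/-- The code lets every terminal recover the sum of all the messages. The blocks `Y` carried by the
edges exist and are unique, see `Code.existsUnique_carries`. -/
def Code.RecoversSum {N : Network V E S T} {A : Type*} [Fintype S] [AddCommMonoid A] {k n : ℕ}
    (C : N.Code A k n) : Prop :=
  ∀ X : S → Fin k → A, ∃ Y : E → Fin n → A, C.Carries X Y ∧
    ∀ t, C.decode t (fun e => Y e.1) = ∑ s, X s

/-- Regarded as a sum-network, `N` is solvable over the abelian group `A`. -/
def SumSolvable (N : Network V E S T) (A : Type*) [Fintype S] [AddCommGroup A] : Prop :=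
  ∃ C : N.Code A 1 1, C.RecoversSum

/-- Regarded as a sum-network, `N` is `k`-length vector linear solvable over the field `F`. -/
def SumLinearSolvable (N : Network V E S T) (F : Type*) [Fintype S] [Field F] (k : ℕ) : Prop :=
  ∃ C : N.Code F k k, C.IsLinear ∧ C.RecoversSum

theorem wellFounded_edge (N : Network V E S T) :
    WellFounded (fun e' e : E => N.head e' = N.tail e) := by
  have := N.finite_edge
  have htr : IsTrans E (Relation.TransGen (fun e' e : E => N.head e' = N.tail e)) :=
    ⟨fun _ _ _ => Relation.TransGen.trans⟩
  have hir : Std.Irrefl (Relation.TransGen (fun e' e : E => N.head e' = N.tail e)) :=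
    ⟨fun e h => N.acyclic (N.tail e)
      (h.lift N.tail (fun e' _ h' => ⟨e', rfl, h'⟩))⟩
  have hwf := Finite.wellFounded_of_trans_of_irrefl
    (Relation.TransGen (fun e' e : E => N.head e' = N.tail e))
  exact ⟨fun e => (hwf.apply e).recOn fun x _ ih =>
    ⟨x, fun y h => ih y (Relation.TransGen.single h)⟩⟩

theorem Code.existsUnique_carries {N : Network V E S T} {A : Type*} {k n : ℕ}
    (C : N.Code A k n) (X : S → Fin k → A) : ∃! Y, C.Carries X Y := by
  refine ⟨N.wellFounded_edge.fix
    (fun e Y => C.edge e (fun s => X s.1) (fun e' => Y e'.1 e'.2)), ?_, ?_⟩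
  · intro e
    exact N.wellFounded_edge.fix_eq _ e
  · intro Z hZ
    funext e
    induction e using N.wellFounded_edge.induction with
    | _ e ih =>
      rw [N.wellFounded_edge.fix_eq, hZ e]
      congr 1
      funext e'
      exact ih e'.1 e'.2

end Network

/-- A Type IA network: the source `i` generates one process, and the terminal `t` demands the process
generated by the source `demand t`. -/
structure TypeIANetwork (V E S T : Type) extends Network V E S T where
  demand : T → S

/-! ### The construction of a sum-network from a Type IA network -/

/-- The vertices of the sum-network. The sources are `s (some i)`, for the sources `i` of the
given network, and one extra source `s none`. The terminals are `tR i`, for the sources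
`i`, and `tL t`, for the terminals `t` of the given network. -/
inductive C2Vertex (V S T : Type) where
  | base (x : V)
  | s (i : Option S)
  | u (i : S)
  | v (i : S)
  | tR (i : S)
  | tL (t : T)

/-- The edges of the sum-network, see `C2Edge.tail` and `C2Edge.head`. -/
inductive C2Edge (E S T : Type) where
  | base (e : E)
  | sw (i : S)
  | su (i j : S) (h : i ≠ j)
  | lastu (j : S)
  | sR (i : S)
  | uv (i : S)
  | vR (i : S)
  | vL (t : T)
  | zL (t : T)

namespace TypeIANetwork

variable {V E S T : Type}

def c2Tail (N : TypeIANetwork V E S T) : C2Edge E S T → C2Vertex V S T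
  | .base e => .base (N.tail e)
  | .sw i => .s (some i)
  | .su i _ _ => .s (some i)
  | .lastu _ => .s none
  | .sR i => .s (some i)
  | .uv i => .u i
  | .vR i => .v i
  | .vL t => .v (N.demand t)
  | .zL t => .base (N.term t)

def c2Head (N : TypeIANetwork V E S T) : C2Edge E S T → C2Vertex V S T
  | .base e => .base (N.head e)
  | .sw i => .base (N.src i)
  | .su _ j _ => .u j
  | .lastu j => .u j
  | .sR i => .tR i
  | .uv i => .v i
  | .vR i => .tR i
  | .vL t => .tL t
  | .zL t => .tL t

/-- A rank that increases strictly along all edges of the sum-network but those of the given network. -/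
def c2Level : C2Vertex V S T → ℕ
  | .s _ => 0
  | .base _ => 1
  | .u _ => 1
  | .v _ => 2
  | .tR _ => 3
  | .tL _ => 3

theorem c2_acyclic_aux (N : TypeIANetwork V E S T) {x y : C2Vertex V S T}
    (h : Relation.TransGen (fun x y => ∃ e, N.c2Tail e = x ∧ N.c2Head e = y) x y) :
    c2Level x < c2Level y ∨ ∃ a b, x = .base a ∧ y = .base b ∧
      Relation.TransGen (fun x y => ∃ e, N.tail e = x ∧ N.head e = y) a b := by
  have step : ∀ x y : C2Vertex V S T, (∃ e, N.c2Tail e = x ∧ N.c2Head e = y) →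
      c2Level x < c2Level y ∨ ∃ a b, x = .base a ∧ y = .base b ∧
        Relation.TransGen (fun x y => ∃ e, N.tail e = x ∧ N.head e = y) a b := by
    rintro _ _ ⟨e, rfl, rfl⟩
    cases e with
    | base e => exact Or.inr ⟨_, _, rfl, rfl, .single ⟨e, rfl, rfl⟩⟩
    | _ => left; simp [c2Tail, c2Head, c2Level]
  induction h with
  | single h => exact step _ _ h
  | tail _ h ih =>
    rcases ih with ih | ⟨a, b, rfl, rfl, hab⟩
    · rcases step _ _ h with h' | ⟨a', b', rfl, rfl, _⟩
      · exact Or.inl (ih.trans h')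
      · exact Or.inl ih
    · rcases step _ _ h with h' | ⟨a', b', hb, rfl, hab'⟩
      · exact Or.inl h'
      · cases hb
        exact Or.inr ⟨_, _, rfl, rfl, hab.trans hab'⟩

theorem finite_c2Vertex [Finite V] [Finite S] [Finite T] : Finite (C2Vertex V S T) := by
  let f : C2Vertex V S T → V ⊕ Option S ⊕ S ⊕ S ⊕ S ⊕ T := fun x => match x with
    | .base x => .inl x
    | .s i => .inr (.inl i)
    | .u i => .inr (.inr (.inl i))
    | .v i => .inr (.inr (.inr (.inl i)))
    | .tR i => .inr (.inr (.inr (.inr (.inl i))))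
    | .tL t => .inr (.inr (.inr (.inr (.inr t))))
  refine Finite.of_injective f ?_
  intro x y h
  cases x <;> cases y <;> simp_all [f]

theorem finite_c2Edge [Finite E] [Finite S] [Finite T] : Finite (C2Edge E S T) := by
  let f : C2Edge E S T → E ⊕ S ⊕ (S × S) ⊕ S ⊕ S ⊕ S ⊕ S ⊕ T ⊕ T := fun x => match x with
    | .base e => .inl e
    | .sw i => .inr (.inl i)
    | .su i j _ => .inr (.inr (.inl (i, j)))
    | .lastu j => .inr (.inr (.inr (.inl j)))
    | .sR i => .inr (.inr (.inr (.inr (.inl i))))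
    | .uv i => .inr (.inr (.inr (.inr (.inr (.inl i)))))
    | .vR i => .inr (.inr (.inr (.inr (.inr (.inr (.inl i))))))
    | .vL t => .inr (.inr (.inr (.inr (.inr (.inr (.inr (.inl t)))))))
    | .zL t => .inr (.inr (.inr (.inr (.inr (.inr (.inr (.inr t)))))))
  refine Finite.of_injective f ?_
  intro x y h
  cases x <;> cases y <;> simp_all [f]

/-- The sum-network constructed from a Type IA network. -/
def c2 (N : TypeIANetwork V E S T) :
    Network (C2Vertex V S T) (C2Edge E S T) (Option S) (S ⊕ T) where
  tail := N.c2Tail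
  head := N.c2Head
  src := .s
  term := Sum.elim .tR .tL
  finite_vertex := by
    have := N.finite_vertex
    have := Finite.of_injective _ N.src_injective
    have := Finite.of_injective _ N.term_injective
    exact finite_c2Vertex
  finite_edge := by
    have := N.finite_vertex
    have := N.finite_edge
    have := Finite.of_injective _ N.src_injective
    have := Finite.of_injective _ N.term_injective
    exact finite_c2Edge
  src_injective := by
    intro i j h
    cases h
    rfl
  term_injective := by
    rintro (i | i) (j | j) h <;> cases h <;> rfl
  head_ne_src := by
    intro e i
    cases e <;> simp [c2Head]
  acyclic := by
    intro x h
    rcases N.c2_acyclic_aux h with h | ⟨a, b, rfl, h, hab⟩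
    · exact lt_irrefl _ h
    · cases h
      exact N.acyclic _ hab

end TypeIANetwork

/-! ### The Dougherty–Freiling–Zeger network -/

/-- The five messages. -/
inductive DFZMsg where
  | a | b | c | d | e
  deriving DecidableEq

/-- The twelve bottleneck edges, named after the messages on which their blocks may depend:
`ab`, `bc`, `abcF`, `abcF'` belong to the part modelled on the Fano matroid; `abc`, `ab'`, `ac'`,
`bc'` and `cde`, `cd`, `ce`, `de` to two parts modelled on the non-Fano matroid. -/
inductive DFZCoded where
  | ab | bc | abcF | abcF'
  | abc | ab' | ac' | bc'
  | cde | cd | ce | de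
  deriving DecidableEq

/-- The ten terminals. -/
inductive DFZTerm where
  | c₀ | b₀ | a₀
  | c₁ | b₁ | a₁
  | c₂ | e₂ | d₂
  | last
  deriving DecidableEq

/-- The vertices: a source for every message, the two ends `into q` and `out q` of every bottleneck
edge `q`, and the terminals. -/
inductive DFZVertex where
  | msg (i : DFZMsg)
  | into (q : DFZCoded)
  | out (q : DFZCoded)
  | term (r : DFZTerm)
  deriving DecidableEq

instance : Fintype DFZMsg where
  elems := {.a, .b, .c, .d, .e}
  complete i := by cases i <;> decide

instance : Fintype DFZCoded where
  elems := {.ab, .bc, .abcF, .abcF', .abc, .ab', .ac', .bc', .cde, .cd, .ce, .de}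
  complete q := by cases q <;> decide

instance : Fintype DFZTerm where
  elems := {.c₀, .b₀, .a₀, .c₁, .b₁, .a₁, .c₂, .e₂, .d₂, .last}
  complete r := by cases r <;> decide

instance : Finite DFZVertex := by
  let f : DFZVertex → DFZMsg ⊕ DFZCoded ⊕ DFZCoded ⊕ DFZTerm := fun x => match x with
    | .msg i => .inl i
    | .into q => .inr (.inl q)
    | .out q => .inr (.inr (.inl q))
    | .term r => .inr (.inr (.inr r))
  refine Finite.of_injective f ?_
  intro x y h
  cases x <;> cases y <;> simp_all [f]

namespace DFZ

open DFZVertex in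
/-- The vertices with an edge to `into q`. -/
def feeds : DFZCoded → List DFZVertex
  | .ab => [msg .a, msg .b]
  | .bc => [msg .b, msg .c]
  | .abcF => [out .ab, msg .c]
  | .abcF' => [out .ab, out .bc]
  | .abc => [msg .a, msg .b, msg .c]
  | .ab' => [msg .a, msg .b]
  | .ac' => [msg .a, msg .c]
  | .bc' => [msg .b, msg .c]
  | .cde => [msg .c, msg .d, msg .e]
  | .cd => [msg .c, msg .d]
  | .ce => [msg .c, msg .e]
  | .de => [msg .d, msg .e]

open DFZVertex in
/-- The vertices with an edge to the terminal `r`. -/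
def taps : DFZTerm → List DFZVertex
  | .c₀ => [msg .a, out .abcF']
  | .b₀ => [out .abcF, out .abcF']
  | .a₀ => [out .abcF, out .bc]
  | .c₁ => [out .abc, out .ab']
  | .b₁ => [out .abc, out .ac']
  | .a₁ => [out .abc, out .bc']
  | .c₂ => [out .cde, out .de]
  | .e₂ => [out .cde, out .cd]
  | .d₂ => [out .cde, out .ce]
  | .last => [out .ab', out .ac', out .bc', out .cd, out .ce, out .de]

/-- The message demanded by each terminal. -/
def demand : DFZTerm → DFZMsg
  | .c₀ => .c
  | .b₀ => .b
  | .a₀ => .a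
  | .c₁ => .c
  | .b₁ => .b
  | .a₁ => .a
  | .c₂ => .c
  | .e₂ => .e
  | .d₂ => .d
  | .last => .c

/-- The set of edges, as ordered pairs of vertices. -/
def Adj : DFZVertex → DFZVertex → Prop
  | x, .into q => x ∈ feeds q
  | x, .out q => x = .into q
  | x, .term r => x ∈ taps r
  | _, .msg _ => False

abbrev Edge : Type := {p : DFZVertex × DFZVertex // Adj p.1 p.2}

/-- A rank that increases strictly along all edges. -/
def level : DFZVertex → ℕ
  | .msg _ => 0
  | .into .abcF => 3
  | .into .abcF' => 3
  | .into _ => 1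
  | .out .abcF => 4
  | .out .abcF' => 4
  | .out _ => 2
  | .term _ => 5

theorem level_lt {x y : DFZVertex} (h : Adj x y) : level x < level y := by
  have hf : ∀ q, ∀ x ∈ feeds q, level x < level (.into q) := by decide
  have ht : ∀ r, ∀ x ∈ taps r, level x < level (.term r) := by decide
  cases y with
  | msg i => exact h.elim
  | into q => exact hf q x h
  | out q =>
    cases h
    cases q <;> decide
  | term r => exact ht r x h

/-- The Dougherty–Freiling–Zeger network. -/
def network : TypeIANetwork DFZVertex Edge DFZMsg DFZTerm where
  tail e := e.1.1
  head e := e.1.2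
  src := .msg
  term := .term
  finite_vertex := inferInstance
  finite_edge := inferInstance
  src_injective := by
    intro i j h
    cases h
    rfl
  term_injective := by
    intro i j h
    cases h
    rfl
  head_ne_src := by
    rintro ⟨⟨x, y⟩, h⟩ i (rfl : y = _)
    exact h
  acyclic := by
    have key : ∀ x y, Relation.TransGen
        (fun x y => ∃ e : Edge, e.1.1 = x ∧ e.1.2 = y) x y → level x < level y := by
      intro x y h
      induction h with
      | single h =>
        obtain ⟨e, rfl, rfl⟩ := h
        exact level_lt e.2
      | tail _ h ih =>
        obtain ⟨e, rfl, rfl⟩ := h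
        exact ih.trans (level_lt e.2)
    exact fun v h => lt_irrefl _ (key v v h)
  demand := demand

end DFZ

/-! The construction makes the sum demand equivalent, in the direction needed in each half, to the
demands of the Type IA network. The vertex `v i` can carry the sum of all messages but the `i`-th;
adding the message decoded at a terminal of the original network completes the sum.

Solvability: on an alphabet of four elements the Fano part works with the addition of a field of
characteristic two, while the non-Fano parts may use the addition of `ZMod 4`. At the last terminal
each non-Fano part determines only the double of an image of `c` in `ZMod 4`, that is, one bit. The
two parts identify the alphabet with `ZMod 4` so that these bits are different, and together they
give `c`.

No linear solution: a linear code of length `k` attaches to every edge a vector of coefficients in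
`R = End(F^k)`, lying in the left span of the vectors available at its tail. `R` is Dedekind-finite,
so one-sided inverses are two-sided; this suffices to restrict a linear solution to the original
network (`TypeIANetwork.single_demand_mem_span`). There the Fano part forces `2 = 0` in `R`
(`two_eq_zero_of_fano`). With `2 = 0`, each non-Fano part contributes nothing to the coefficient of
`c` at the last terminal (`nonFano_combination_eq_zero`), so `1 = 0` in `R`, which is absurd for `k
> 0`. -/

/-! ### Scalar solutions of the sum-network -/

/-- A sum-network is solvable as soon as the blocks carried by its edges are determined by the
messages and blocks available at their tails, and the sum is determined at every terminal. -/
theorem Network.sumSolvable_of_determined {V E S T : Type} {A : Type*} [Fintype S]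
    [AddCommGroup A] (N : Network V E S T) (Y : (S → Fin 1 → A) → E → Fin 1 → A)
    (hY : ∀ e X X', (∀ s, N.src s = N.tail e → X s = X' s) →
      (∀ e', N.head e' = N.tail e → Y X e' = Y X' e') → Y X e = Y X' e)
    (hT : ∀ t X X', (∀ e, N.head e = N.term t → Y X e = Y X' e) → ∑ s, X s = ∑ s, X' s) :
    N.SumSolvable A := by
  classical
  -- Each function evaluates at an arbitrary choice of messages compatible with its input. The
  -- default `0` is only taken on inputs that never occur.
  refine ⟨⟨fun e p q => if h : ∃ X, (fun s : {s // N.src s = N.tail e} => X s.1) = p ∧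
      (fun e' : {e' // N.head e' = N.tail e} => Y X e'.1) = q then Y h.choose e else 0,
    fun t q => if h : ∃ X, (fun e' : {e' // N.head e' = N.term t} => Y X e'.1) = q then
      ∑ s, h.choose s else 0⟩, fun X => ⟨Y X, fun e => ?_, fun t => ?_⟩⟩
  · have h : ∃ X', (fun s : {s // N.src s = N.tail e} => X' s.1) = (fun s => X s.1) ∧
      (fun e' : {e' // N.head e' = N.tail e} => Y X' e'.1) = (fun e' => Y X e'.1) := ⟨X, rfl, rfl⟩
    simp only [dif_pos h]
    exact (hY e _ _ (fun s hs => congrFun h.choose_spec.1 ⟨s, hs⟩)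
      (fun e' he' => congrFun h.choose_spec.2 ⟨e', he'⟩)).symm
  · have h : ∃ X', (fun e' : {e' // N.head e' = N.term t} => Y X' e'.1) = (fun e' => Y X e'.1) :=
      ⟨X, rfl⟩
    simp only [dif_pos h]
    exact hT t _ _ (fun e he => congrFun h.choose_spec ⟨e, he⟩)

/-- A scalar solution of a Type IA network, given by the blocks `B` that its edges carry, yields a
scalar solution of the sum-network. -/
theorem TypeIANetwork.c2_sumSolvable {V E S T : Type} {A : Type*} [Fintype S]
    [AddCommGroup A] (N : TypeIANetwork V E S T) (B : (S → A) → E → A)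
    (hB : ∀ e x x', (∀ s, N.src s = N.tail e → x s = x' s) →
      (∀ e', N.head e' = N.tail e → B x e' = B x' e') → B x e = B x' e)
    (hD : ∀ t x x', (∀ e, N.head e = N.term t → B x e = B x' e) →
      x (N.demand t) = x' (N.demand t)) :
    N.c2.SumSolvable A := by
  classical
  let Y : (Option S → Fin 1 → A) → C2Edge E S T → Fin 1 → A := fun X e => match e with
    | .base e => fun _ => B (fun i => X (some i) 0) e
    | .sw i => X (some i)
    | .su i _ _ => X (some i)
    | .lastu _ => X none
    | .sR i => X (some i)
    | .uv i => ∑ s, X s - X (some i)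
    | .vR i => ∑ s, X s - X (some i)
    | .vL t => ∑ s, X s - X (some (N.demand t))
    | .zL t => X (some (N.demand t))
  refine N.c2.sumSolvable_of_determined Y ?_ ?_
  · intro e X X' hS hE
    change ∀ s, C2Vertex.s s = N.c2Tail e → _ at hS
    change ∀ e', N.c2Head e' = N.c2Tail e → _ at hE
    cases e with
    | base e =>
      funext j
      refine hB e _ _ (fun s hs => ?_) (fun e' he' => ?_)
      · exact congrFun (hE (.sw s) (congrArg C2Vertex.base hs)) 0
      · exact congrFun (hE (.base e') (congrArg C2Vertex.base he')) 0
    | sw i => exact hS (some i) rfl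
    | su i _ _ => exact hS (some i) rfl
    | lastu j => exact hS none rfl
    | sR i => exact hS (some i) rfl
    | uv i =>
      -- The edges entering `u i` carry every message except the `i`-th, including the extra one.
      have key : ∀ X : Option S → Fin 1 → A, ∑ s, X s - X (some i) =
          X none + ∑ j ∈ Finset.univ.erase i, X (some j) := by
        intro X
        rw [Fintype.sum_option, ← Finset.add_sum_erase _ _ (Finset.mem_univ i)]
        abel
      change ∑ s, X s - X (some i) = ∑ s, X' s - X' (some i)
      rw [key, key, show X none = X' none from hE (.lastu i) rfl]
      congr 1
      exact Finset.sum_congr rfl fun j hj => hE (.su j i (Finset.ne_of_mem_erase hj)) rfl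
    | vR i => exact hE (.uv i) rfl
    | vL t => exact hE (.uv (N.demand t)) rfl
    | zL t =>
      funext j
      rw [Subsingleton.elim j 0]
      exact hD t _ _ fun e he => congrFun (hE (.base e) (congrArg C2Vertex.base he)) 0
  · intro t X X' h
    change ∀ e, N.c2Head e = _ → _ at h
    cases t with
    | inl i =>
      have h1 : X (some i) = X' (some i) := h (.sR i) rfl
      have h2 : ∑ s, X s - X (some i) = ∑ s, X' s - X' (some i) := h (.vR i) rfl
      rwa [h1, sub_left_inj] at h2
    | inr t =>
      have h1 : X (some (N.demand t)) = X' (some (N.demand t)) := h (.zL t) rfl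
      have h2 : ∑ s, X s - X (some (N.demand t)) = ∑ s, X' s - X' (some (N.demand t)) :=
        h (.vL t) rfl
      rwa [h1, sub_left_inj] at h2

/-! ### A nonlinear solution over the field with four elements -/

namespace DFZ

/-- The blocks carried by the bottleneck edges: the part modelled on the Fano matroid uses the
addition of `A`, the other two parts use the addition of `ZMod 4`, transported along two bijections
that reverse the order of the two bits of the message `c`. -/
def coded {A : Type*} [Add A] (σ τ : A ≃ ZMod 4) (x : DFZMsg → A) : DFZCoded → A
  | .ab => x .a + x .b
  | .bc => x .b + x .c
  | .abcF => x .a + x .b + x .c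
  | .abcF' => (x .a + x .b) + (x .b + x .c)
  | .abc => σ.symm (σ (x .a) + σ (x .b) + τ (x .c))
  | .ab' => σ.symm (σ (x .a) + σ (x .b))
  | .ac' => σ.symm (σ (x .a) + τ (x .c))
  | .bc' => σ.symm (σ (x .b) + τ (x .c))
  | .cde => σ.symm (σ (x .c) + σ (x .d) + σ (x .e))
  | .cd => σ.symm (σ (x .c) + σ (x .d))
  | .ce => σ.symm (σ (x .c) + σ (x .e))
  | .de => σ.symm (σ (x .d) + σ (x .e))

/-- The block carried by the edges leaving a vertex. -/
def blockFrom {A : Type*} [AddMonoid A] (σ τ : A ≃ ZMod 4) (x : DFZMsg → A) : DFZVertex → A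
  | .msg i => x i
  | .into q => coded σ τ x q
  | .out q => coded σ τ x q
  | .term _ => 0

theorem c2_sumSolvable {K : Type*} [Field K] [CharP K 2] (hK : Nat.card K = 4) :
    network.c2.SumSolvable K := by
  have : Finite K := Nat.finite_of_card_ne_zero (by omega)
  obtain ⟨σ⟩ : Nonempty (K ≃ ZMod 4) := by
    rw [← Finite.card_eq]
    simp [hK]
  -- Doubling in `ZMod 4` retains only the low bit. Swapping `1` and `2` exchanges the two bits, so
  -- the doubles under `σ` and `τ` determine both bits.
  let ρ : Equiv.Perm (ZMod 4) := Equiv.swap 1 2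
  let τ : K ≃ ZMod 4 := σ.trans ρ
  have hστ : ∀ c c' : K, 2 * σ c = 2 * σ c' → 2 * τ c = 2 * τ c' → c = c' := by
    have h : ∀ c c' : ZMod 4, 2 * c = 2 * c' → 2 * Equiv.swap 1 2 c = 2 * Equiv.swap 1 2 c' →
      c = c' := by decide
    exact fun c c' h1 h2 => σ.injective (h _ _ h1 h2)
  have two : (2 : K) = 0 := CharTwo.two_eq_zero
  clear_value τ
  refine network.c2_sumSolvable (fun x e => blockFrom σ τ x e.1.1) ?_ ?_
  · rintro ⟨⟨v, y⟩, hvy⟩ x x' hS hE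
    change ∀ s, DFZVertex.msg s = v → _ at hS
    have hE' : ∀ w, Adj w v → blockFrom σ τ x w = blockFrom σ τ x' w := fun w hw =>
      hE ⟨(w, v), hw⟩ rfl
    change blockFrom σ τ x v = blockFrom σ τ x' v
    cases v with
    | msg i => exact hS i rfl
    | into q =>
      change ∀ w ∈ feeds q, _ at hE'
      cases q <;> simp only [feeds, List.forall_mem_cons, blockFrom, coded] at hE' ⊢ <;>
        simp only [hE']
    | out q => exact hE' (.into q) rfl
    | term r => rfl
  · intro r x x' hE
    have hE' : ∀ w ∈ taps r, blockFrom σ τ x w = blockFrom σ τ x' w := fun w hw =>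
      hE ⟨(w, .term r), hw⟩ rfl
    change x (demand r) = x' (demand r)
    cases r <;> simp only [taps, List.forall_mem_cons, blockFrom, coded,
      EmbeddingLike.apply_eq_iff_eq] at hE' <;> simp only [demand]
    case c₀ =>
      obtain ⟨h1, h2, -⟩ := hE'
      linear_combination h2 - h1 - (x .b - x' .b) * two
    case b₀ =>
      obtain ⟨h1, h2, -⟩ := hE'
      linear_combination h1 - h2 + (x .b - x' .b) * two
    case a₀ =>
      obtain ⟨h1, h2, -⟩ := hE'
      linear_combination h1 - h2
    case c₁ => exact τ.injective (by linear_combination hE'.1 - hE'.2.1)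
    case b₁ => exact σ.injective (by linear_combination hE'.1 - hE'.2.1)
    case a₁ => exact σ.injective (by linear_combination hE'.1 - hE'.2.1)
    case c₂ => exact σ.injective (by linear_combination hE'.1 - hE'.2.1)
    case e₂ => exact σ.injective (by linear_combination hE'.1 - hE'.2.1)
    case d₂ => exact σ.injective (by linear_combination hE'.1 - hE'.2.1)
    case last =>
      obtain ⟨h1, h2, h3, h4, h5, h6, -⟩ := hE'
      exact hστ _ _ (by linear_combination h4 + h5 - h6) (by linear_combination h2 + h3 - h1)

end DFZ

/-! ### Linear algebra over a noncommutative coefficient ring -/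

/-- Used as a rewriting rule, this peels off the incoming vectors one by one and turns span
membership into explicit coefficients. -/
theorem mem_span_list_cons {R M α : Type*} [Ring R] [AddCommGroup M] [Module R M] {f : α → M}
    {x : α} {l : List α} {v : M} :
    v ∈ Submodule.span R {m | ∃ y ∈ x :: l, f y = m} ↔
      ∃ r : R, ∃ m ∈ Submodule.span R {m | ∃ y ∈ l, f y = m}, v = r • f x + m := by
  rw [← Submodule.mem_span_insert]
  congr! 3
  ext m
  simp [eq_comm]

theorem mem_span_list_nil {R M α : Type*} [Ring R] [AddCommGroup M] [Module R M] {f : α → M}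
    {v : M} : v ∈ Submodule.span R {m | ∃ y ∈ ([] : List α), f y = m} ↔ v = 0 := by
  simp

section DedekindFinite

variable {R : Type*} [Ring R] [IsDedekindFiniteMonoid R]

/-- A linear solution of the network modelled on the Fano matroid requires characteristic two. -/
theorem two_eq_zero_of_fano {wa wb yb yc h₁ h₂ l₁ l₂ q u v r s : R}
    (cb : q * (l₁ * wb + l₂ * yb) = 0) (cc : q * (l₂ * yc) = 1)
    (ba : u * (h₁ * wa) + v * (l₁ * wa) = 0)
    (bb : u * (h₁ * wb) + v * (l₁ * wb + l₂ * yb) = 1)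
    (bc : u * h₂ + v * (l₂ * yc) = 0)
    (aa : r * (h₁ * wa) = 1) (ab : r * (h₁ * wb) + s * yb = 0) (ac : r * h₂ + s * yc = 0) :
    (2 : R) = 0 := by
  have cc' : l₂ * yc * q = 1 := mul_eq_one_symm cc
  -- Here `w = wa a + wb b`, `y = yb b + yc c`, `x = h₁ w + h₂ c`, `z = l₁ w + l₂ y`. Up to scaling
  -- the argument is: `z` must be free of `b`, so `z = a - c`; recovering `a` from `x` and `y`
  -- forces `x = a + b + c`; then `x - z = b + 2c` must be `b`.
  have e1 : l₁ * wb + l₂ * yb = 0 := by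
    calc l₁ * wb + l₂ * yb = l₂ * yc * (q * (l₁ * wb + l₂ * yb)) := by
          rw [← mul_assoc, cc', one_mul]
      _ = 0 := by rw [cb, mul_zero]
  have bb' : u * (h₁ * wb) = 1 := by rw [e1, mul_zero, add_zero] at bb; exact bb
  have waInv : wa * (r * h₁) = 1 := mul_eq_one_symm (by rw [mul_assoc]; exact aa)
  -- This is the total coefficient of `w` in `u x + v z`; it vanishes because `wa` is invertible and
  -- `a` must cancel.
  have e2 : u * h₁ + v * l₁ = 0 := by
    calc u * h₁ + v * l₁ = (u * (h₁ * wa) + v * (l₁ * wa)) * (r * h₁) := by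
          calc _ = (u * h₁ + v * l₁) * (wa * (r * h₁)) := by rw [waInv, mul_one]
            _ = _ := by noncomm_ring
      _ = 0 := by rw [ba, zero_mul]
  have e3 : v * l₂ * yb = 1 := by
    calc v * l₂ * yb = u * (h₁ * wb) + v * (l₁ * wb + l₂ * yb) - (u * h₁ + v * l₁) * wb := by
          noncomm_ring
      _ = 1 := by rw [e2, e1, bb']; simp
  have e3' : yb * (v * l₂) = 1 := mul_eq_one_symm e3
  have e4 : r * (h₁ * wb) * (v * l₂) + s = 0 := by
    calc r * (h₁ * wb) * (v * l₂) + s = (r * (h₁ * wb) + s * yb) * (v * l₂) := by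
          rw [add_mul, mul_assoc s, e3', mul_one]
      _ = 0 := by rw [ab, zero_mul]
  have e5 : r * (h₂ - h₁ * wb * (v * l₂) * yc) = 0 := by
    calc r * (h₂ - h₁ * wb * (v * l₂) * yc)
        = r * h₂ + s * yc - (r * (h₁ * wb) * (v * l₂) + s) * yc := by noncomm_ring
      _ = 0 := by rw [e4, ac]; simp
  -- By `e3` and `e3'`, `v * l₂` is the inverse of `yb`, so `h₂` is `h₁ * wb * yb⁻¹ * yc`.
  have e6 : h₂ = h₁ * wb * (v * l₂) * yc := by
    rw [← sub_eq_zero, ← one_mul (h₂ - _), ← mul_eq_one_symm aa, mul_assoc, e5, mul_zero]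
  have e7 : 2 * (v * l₂ * yc) = 0 := by
    calc 2 * (v * l₂ * yc) = u * (h₁ * wb) * (v * l₂ * yc) + v * (l₂ * yc) := by
          rw [bb']; noncomm_ring
      _ = u * h₂ + v * (l₂ * yc) := by rw [e6]; noncomm_ring
      _ = 0 := bc
  have e8 : v * l₂ * yc * (q * l₂ * yb) = 1 := by
    calc v * l₂ * yc * (q * l₂ * yb) = v * (l₂ * yc * q) * l₂ * yb := by noncomm_ring
      _ = 1 := by rw [cc', mul_one, e3]
  calc (2 : R) = 2 * (v * l₂ * yc) * (q * l₂ * yb) := by rw [mul_assoc, e8, mul_one]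
    _ = 0 := by rw [e7, zero_mul]

/-- Since `d` and `p` are invertible, `d' * m = -(d * p)` makes `d'` invertible. The two
cancellations then say that `(m, m')` is a left multiple of `(p, p')`, and `j` is the inverse of
`p`. -/
theorem eq_mul_inv_mul_of_cancel {p p' c j d d' m m' : R} (h : d * p + d' * m = 0)
    (h' : d * p' + d' * m' = 0) (hc : d * c = 1) (hj : j * p = 1) : m' = m * j * p' := by
  have hj' : p * j = 1 := mul_eq_one_symm hj
  have h1 : d' * (m * (-(j * c))) = 1 := by
    calc d' * (m * (-(j * c))) = d * (p * j) * c - (d * p + d' * m) * (j * c) := by noncomm_ring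
      _ = 1 := by rw [h, hj', mul_one, hc]; simp
  have h2 : d' * (m' - m * j * p') = 0 := by
    calc d' * (m' - m * j * p')
        = d * p' + d' * m' - d * p' + d * (p * j) * p' - (d * p + d' * m) * j * p' := by
          noncomm_ring
      _ = 0 := by rw [h, h', hj']; simp
  have h3 := mul_eq_one_symm h1
  rw [← sub_eq_zero, ← one_mul (m' - _), ← h3, mul_assoc, h2, mul_zero]

/-- In characteristic two, a linear solution of the network modelled on the non-Fano matroid does
not allow to recover `c` from the three blocks depending on two messages each. -/
theorem nonFano_combination_eq_zero (two : (2 : R) = 0)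
    {pa pb pc ma mb na nc kb kc d d' g g' j j' α β γ : R}
    (ca : d * pa + d' * ma = 0) (cb : d * pb + d' * mb = 0) (cc : d * pc = 1)
    (ba : g * pa + g' * na = 0) (bb : g * pb = 1) (bc : g * pc + g' * nc = 0)
    (aa : j * pa = 1) (ab : j * pb + j' * kb = 0) (ac : j * pc + j' * kc = 0)
    (la : α * ma + β * na = 0) (lb : α * mb + γ * kb = 0) : β * nc + γ * kc = 0 := by
  -- Up to left multiples the three blocks are the partial sums of `pa a + pb b + pc c` over two
  -- messages. After rescaling, a combination of `a + b`, `a + c`, `b + c` free of `a` and `b` is a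
  -- multiple of `2c`.
  have e1 := eq_mul_inv_mul_of_cancel ca cb cc aa
  have e2 := eq_mul_inv_mul_of_cancel ba bc bb aa
  have e3 := eq_mul_inv_mul_of_cancel ab ac aa bb
  have hb : pb * g = 1 := mul_eq_one_symm bb
  calc β * nc + γ * kc = (α * ma + β * na) * j * pc + (α * mb + γ * kb) * g * pc
        - (α * ma * j * pc + α * mb * g * pc) := by rw [e2, e3]; noncomm_ring
    _ = -(α * ma * j * pc + α * (ma * j * (pb * g)) * pc) := by
        rw [la, lb, e1]; simp [mul_assoc]
    _ = -(2 * (α * ma * j * pc)) := by rw [hb]; noncomm_ring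
    _ = 0 := by rw [two]; simp

end DedekindFinite

/-! ### From linear codes to coefficients in a ring -/

/-- A linear solution of a sum-network with coefficients in a ring `R`: the block carried by the edge
`e` is the combination of the messages with the coefficients `coeff e`. -/
structure Network.LinearSolution {V E S T : Type} (N : Network V E S T) (R : Type*) [Ring R]
    [DecidableEq S] where
  coeff : E → S → R
  coeff_mem : ∀ e, coeff e ∈ Submodule.span R
    ({m | ∃ s, N.src s = N.tail e ∧ Pi.single s 1 = m} ∪
      {m | ∃ e', N.head e' = N.tail e ∧ coeff e' = m})
  one_mem : ∀ t, 1 ∈ Submodule.span R {m | ∃ e, N.head e = N.term t ∧ coeff e = m}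

theorem IsLinearMap.exists_eq_sum {F ι W W' : Type*} [Field F] [Fintype ι] [AddCommGroup W]
    [Module F W] [AddCommGroup W'] [Module F W'] {f : (ι → W) → W'} (hf : IsLinearMap F f) :
    ∃ M : ι → W →ₗ[F] W', ∀ q, f q = ∑ i, M i (q i) := by
  classical
  refine ⟨fun i => hf.mk' f ∘ₗ LinearMap.single F (fun _ => W) i, fun q => ?_⟩
  simp only [LinearMap.comp_apply, LinearMap.coe_single, ← map_sum, Finset.univ_sum_single]
  rfl

theorem IsLinearMap.exists_eq_sum_add_sum {F ι κ W W' : Type*} [Field F] [Fintype ι] [Fintype κ]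
    [AddCommGroup W] [Module F W] [AddCommGroup W'] [Module F W']
    {f : (ι → W) × (κ → W) → W'} (hf : IsLinearMap F f) :
    ∃ (M : ι → W →ₗ[F] W') (M' : κ → W →ₗ[F] W'),
      ∀ p q, f (p, q) = ∑ i, M i (p i) + ∑ j, M' j (q j) := by
  let L : (ι → W) × (κ → W) →ₗ[F] W' := hf.mk' f
  let L₁ : (ι → W) →ₗ[F] W' := L ∘ₗ LinearMap.inl F (ι → W) (κ → W)
  let L₂ : (κ → W) →ₗ[F] W' := L ∘ₗ LinearMap.inr F (ι → W) (κ → W)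
  obtain ⟨M, hM⟩ := IsLinearMap.exists_eq_sum (F := F) (f := L₁) L₁.isLinear
  obtain ⟨M', hM'⟩ := IsLinearMap.exists_eq_sum (F := F) (f := L₂) L₂.isLinear
  refine ⟨M, M', fun p q => ?_⟩
  rw [← hM, ← hM']
  change L (p, q) = L (p, 0) + L (0, q)
  rw [← L.map_add, Prod.mk_add_mk, add_zero, zero_add]

namespace Network

/-- Uniqueness of the carried blocks makes them depend linearly on the messages. The coefficient of
the message `s` on an edge is the endomorphism sending `v` to the block carried when `s` emits `v`
and all other sources emit `0`. -/
theorem Code.exists_linearSolution {V E S T : Type} {F : Type*} [Fintype S] [DecidableEq S] [Field F]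
    {N : Network V E S T} {k : ℕ} (C : N.Code F k k) (hC : C.IsLinear) (hR : C.RecoversSum) :
    Nonempty (N.LinearSolution (Module.End F (Fin k → F))) := by
  classical
  have := N.finite_edge
  have := Fintype.ofFinite E
  choose Y hY hYu using C.existsUnique_carries
  have hadd : ∀ X X', Y (X + X') = Y X + Y X' := fun X X' => by
    refine (hYu _ _ fun e => ?_).symm
    rw [Pi.add_apply, hY X e, hY X' e]
    exact ((hC.1 e).map_add (_, _) (_, _)).symm
  have hsmul : ∀ (c : F) X, Y (c • X) = c • Y X := fun c X => by
    refine (hYu _ _ fun e => ?_).symm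
    rw [Pi.smul_apply, hY X e]
    exact ((hC.1 e).map_smul c (_, _)).symm
  let coeff : E → S → Module.End F (Fin k → F) := fun e s =>
    { toFun := fun v => Y (Pi.single s v) e
      map_add' := fun v v' => by rw [Pi.single_add, hadd]; rfl
      map_smul' := fun c v => by rw [Pi.single_smul, hsmul]; rfl }
  have hsingle : ∀ (s s' : S) (v : Fin k → F), (Pi.single s v : S → Fin k → F) s' =
      (Pi.single s' 1 : S → Module.End F (Fin k → F)) s v := fun s s' v => by
    by_cases h : s = s'
    · subst h; simp
    · rw [Pi.single_eq_of_ne (Ne.symm h), Pi.single_eq_of_ne h]; rfl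
  refine ⟨⟨coeff, fun e => ?_, fun t => ?_⟩⟩
  · obtain ⟨M, M', hM⟩ := (hC.1 e).exists_eq_sum_add_sum
    have h : coeff e = ∑ s, M s • (Pi.single s.1 1 : S → Module.End F (Fin k → F)) +
        ∑ e', M' e' • coeff e'.1 := by
      funext s
      refine LinearMap.ext fun v => ?_
      have h1 := hM (fun s' => (Pi.single s v : S → Fin k → F) s'.1)
        (fun e' => Y (Pi.single s v) e'.1)
      simp only [← hY (Pi.single s v) e] at h1
      change Y (Pi.single s v) e = _
      rw [h1]
      simp only [hsingle, Pi.add_apply, Finset.sum_apply, LinearMap.add_apply,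
        LinearMap.sum_apply, Pi.smul_apply, smul_eq_mul, Module.End.mul_apply]
      rfl
    rw [h]
    refine add_mem (sum_mem fun s _ => ?_) (sum_mem fun e' _ => ?_)
    · exact Submodule.smul_mem _ _ (Submodule.subset_span (Or.inl ⟨s.1, s.2, rfl⟩))
    · exact Submodule.smul_mem _ _ (Submodule.subset_span (Or.inr ⟨e'.1, e'.2, rfl⟩))
  · obtain ⟨M, hM⟩ := (hC.2 t).exists_eq_sum
    have h : (1 : S → Module.End F (Fin k → F)) = ∑ e, M e • coeff e.1 := by
      funext s
      refine LinearMap.ext fun v => ?_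
      obtain ⟨Z, hZ, hZt⟩ := hR (Pi.single s v)
      obtain rfl := hYu _ _ hZ
      have h1 := hZt t
      rw [Finset.sum_pi_single', if_pos (Finset.mem_univ s), hM] at h1
      simp only [Finset.sum_apply, LinearMap.sum_apply]
      exact h1.symm
    rw [h]
    exact sum_mem fun e _ => Submodule.smul_mem _ _ (Submodule.subset_span ⟨e.1, e.2, rfl⟩)

variable {V E S T : Type} {R : Type*} [Ring R] [DecidableEq S]

/-- With `K` the kernel of a coordinate, this shows that a message absent from the inputs of an edge
is absent from the edge. -/
theorem LinearSolution.coeff_mem_of {N : Network V E S T} (P : N.LinearSolution R)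
    {e : E} {K : Submodule R (S → R)} (hs : ∀ s, N.src s = N.tail e → Pi.single s 1 ∈ K)
    (he : ∀ e', N.head e' = N.tail e → P.coeff e' ∈ K) : P.coeff e ∈ K := by
  refine Submodule.span_le.2 ?_ (P.coeff_mem e)
  rintro _ (⟨s, h, rfl⟩ | ⟨e', h, rfl⟩)
  exacts [hs s h, he e' h]

theorem LinearSolution.one_mem_of {N : Network V E S T} (P : N.LinearSolution R)
    (t : T) {K : Submodule R (S → R)}
    (he : ∀ e, N.head e = N.term t → P.coeff e ∈ K) : 1 ∈ K := by
  refine Submodule.span_le.2 ?_ (P.one_mem t)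
  rintro _ ⟨e, h, rfl⟩
  exact he e h

end Network

/-! ### Restricting linear solutions to the Type IA network -/

namespace TypeIANetwork

variable {V E S T : Type} {R : Type*} [Ring R] [DecidableEq S]
  {N : TypeIANetwork V E S T} (P : N.c2.LinearSolution R)

theorem coeff_mem_span_single {e : C2Edge E S T} {i : Option S} (h : N.c2Tail e = .s i) :
    P.coeff e ∈ Submodule.span R {Pi.single i 1} := by
  refine P.coeff_mem_of (fun s hs => ?_) (fun e' he' => ?_)
  · obtain rfl : s = i := C2Vertex.s.inj (hs.trans h)
    exact Submodule.mem_span_singleton_self _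
  · exact absurd (he'.trans h) (N.c2.head_ne_src e' i)

theorem coeff_apply_eq_zero {e : C2Edge E S T} {i j : Option S} (h : N.c2Tail e = .s i)
    (hij : i ≠ j) : P.coeff e j = 0 := by
  obtain ⟨r, hr⟩ := Submodule.mem_span_singleton.1 (coeff_mem_span_single P h)
  simp [← hr, hij.symm]

theorem coeff_base_none (e : E) : P.coeff (.base e) none = 0 := by
  induction e using N.wellFounded_edge.induction with
  | _ e ih =>
    refine P.coeff_mem_of (K := LinearMap.ker (LinearMap.proj none)) (fun s hs => ?_)
      (fun e' he' => ?_)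
    · cases hs
    · change N.c2Head e' = .base (N.tail e) at he'
      cases e' with
      | base e' => exact ih e' (C2Vertex.base.inj he')
      | sw i => exact coeff_apply_eq_zero P rfl (by simp)
      | _ => cases he'

theorem coeff_uv_self (i : S) : P.coeff (.uv i) (some i) = 0 := by
  refine P.coeff_mem_of (K := LinearMap.ker (LinearMap.proj (some i))) (fun s hs => ?_)
    (fun e' he' => ?_)
  · cases hs
  · change N.c2Head e' = .u i at he'
    cases e' with
    | lastu j => exact coeff_apply_eq_zero P rfl (by simp)
    | su j j' h =>
      obtain rfl : j' = i := C2Vertex.u.inj he'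
      exact coeff_apply_eq_zero P rfl (by simpa using h)
    | _ => cases he'

theorem coeff_mem_span_uv {e : C2Edge E S T} {i : S} (h : N.c2Tail e = .v i) :
    P.coeff e ∈ Submodule.span R {P.coeff (.uv i)} := by
  refine P.coeff_mem_of (fun s hs => ?_) (fun e' he' => ?_)
  · exact absurd (hs.trans h) (by rintro ⟨⟩)
  · replace he' : N.c2Head e' = .v i := he'.trans h
    cases e' with
    | uv j =>
      obtain rfl : j = i := C2Vertex.v.inj he'
      exact Submodule.mem_span_singleton_self _
    | _ => cases he'

/-- The terminal `tR i` sees only multiples of the message `i` and of the block on `uv i`, which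
does not involve that message; hence the former must enter the sum with coefficient `1`. -/
theorem exists_smul_coeff_uv (i : S) :
    ∃ b : R, b • P.coeff (.uv i) = 1 - Pi.single (some i) 1 := by
  have h : (1 : Option S → R) ∈ Submodule.span R {Pi.single (some i) 1, P.coeff (.uv i)} := by
    refine P.one_mem_of (.inl i) fun e he => ?_
    change N.c2Head e = .tR i at he
    cases e with
    | sR j =>
      obtain rfl : j = i := C2Vertex.tR.inj he
      exact Submodule.span_mono (by simp) (coeff_mem_span_single P (i := some j) rfl)
    | vR j =>
      obtain rfl : j = i := C2Vertex.tR.inj he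
      exact Submodule.span_mono (by simp) (coeff_mem_span_uv P (i := j) rfl)
    | _ => cases he
  obtain ⟨a, b, hab⟩ := Submodule.mem_span_pair.1 h
  have ha : a = 1 := by simpa [coeff_uv_self] using congrFun hab (some i)
  subst ha
  exact ⟨b, by rw [← hab, one_smul, add_sub_cancel_left]⟩

/-- A linear solution of the sum-network restricts to a linear solution of the Type IA network. -/
theorem single_demand_mem_span [IsDedekindFiniteMonoid R] {t : T}
    (ht : ∀ i, N.src i ≠ N.term t) :
    Pi.single (some (N.demand t)) 1 ∈
      Submodule.span R {m | ∃ e, N.head e = N.term t ∧ P.coeff (.base e) = m} := by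
  set K := Submodule.span R {m | ∃ e, N.head e = N.term t ∧ P.coeff (.base e) = m}
  have hK0 : ∀ m ∈ K, m none = 0 := by
    intro m hm
    refine Submodule.span_le (p := LinearMap.ker (LinearMap.proj none)).2 ?_ hm
    rintro _ ⟨e, -, rfl⟩
    exact coeff_base_none P e
  have hzL : P.coeff (.zL t) ∈ K := by
    refine P.coeff_mem_of (fun s hs => by cases hs) fun e' he' => ?_
    change N.c2Head e' = .base (N.term t) at he'
    cases e' with
    | base e' => exact Submodule.subset_span ⟨e', C2Vertex.base.inj he', rfl⟩
    | sw i => exact absurd (C2Vertex.base.inj he') (ht i)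
    | _ => cases he'
  have h : (1 : Option S → R) ∈ K ⊔ Submodule.span R {P.coeff (.uv (N.demand t))} := by
    refine P.one_mem_of (.inr t) fun e he => ?_
    change N.c2Head e = .tL t at he
    cases e with
    | zL t' =>
      obtain rfl : t' = t := C2Vertex.tL.inj he
      exact Submodule.mem_sup_left hzL
    | vL t' =>
      obtain rfl : t' = t := C2Vertex.tL.inj he
      exact Submodule.mem_sup_right (coeff_mem_span_uv P rfl)
    | _ => cases he
  obtain ⟨z, hz, y, hy, hzy⟩ := Submodule.mem_sup.1 h
  obtain ⟨c, rfl⟩ := Submodule.mem_span_singleton.1 hy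
  obtain ⟨b, hb⟩ := exists_smul_coeff_uv P (N.demand t)
  -- The extra message reaches `tL t` only through `uv`, so `c` is a left inverse of its coefficient
  -- there. So is `b`, and left inverses coincide in a Dedekind-finite ring. Hence the part coming
  -- from the original network is `1 - (1 - single) = single`.
  have hc1 : c * P.coeff (.uv (N.demand t)) none = 1 := by
    simpa [hK0 z hz] using congrFun hzy none
  have hb1 : b * P.coeff (.uv (N.demand t)) none = 1 := by
    simpa using congrFun hb none
  have hcb : c = b := by
    rw [← mul_one c, ← mul_eq_one_symm hb1, ← mul_assoc, hc1, one_mul]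
  rw [hcb, hb] at hzy
  rwa [show z = Pi.single (some (N.demand t)) 1 from
    (eq_sub_of_add_eq hzy).trans (sub_sub_cancel _ _)] at hz

end TypeIANetwork

/-! ### No linear solution for the Dougherty–Freiling–Zeger network -/

namespace DFZ

variable {R : Type*} [Ring R] (P : network.c2.LinearSolution R)

/-- The coefficients of the block carried by all edges leaving a source or the end of a bottleneck
edge, up to multiples. -/
def coeffAt : DFZVertex → Option DFZMsg → R
  | .msg i => Pi.single (some i) 1
  | .out q => P.coeff (.base ⟨(.into q, .out q), rfl⟩)
  | _ => 0

/-- Exactly one edge of the sum-network enters such a vertex: the one from the new source `s (some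
i)`, or the bottleneck edge itself. -/
theorem coeff_base_mem_span (e : Edge) (he : (∃ i, e.1.1 = .msg i) ∨ ∃ q, e.1.1 = .out q) :
    P.coeff (.base e) ∈ Submodule.span R {coeffAt P e.1.1} := by
  refine P.coeff_mem_of (fun s hs => by cases hs) fun e' he' => ?_
  change network.c2Head e' = .base e.1.1 at he'
  obtain ⟨i, hi⟩ | ⟨q, hq⟩ := he
  · rw [hi] at he' ⊢
    cases e' with
    | base e' =>
      have := C2Vertex.base.inj he'
      exact absurd this (network.head_ne_src e' i)
    | sw j =>
      obtain rfl : j = i := DFZVertex.msg.inj (C2Vertex.base.inj he')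
      exact TypeIANetwork.coeff_mem_span_single P rfl
    | _ => cases he'
  · rw [hq] at he' ⊢
    cases e' with
    | base e' =>
      obtain ⟨⟨x, y⟩, hxy⟩ := e'
      obtain rfl : y = .out q := C2Vertex.base.inj he'
      obtain rfl : x = .into q := hxy
      exact Submodule.mem_span_singleton_self _
    | sw j => exact absurd (C2Vertex.base.inj he') (by rintro ⟨⟩)
    | _ => cases he'

theorem eq_msg_or_out_of_mem_feeds {q : DFZCoded} {x : DFZVertex} (h : x ∈ feeds q) :
    (∃ i, x = .msg i) ∨ ∃ q', x = .out q' := by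
  revert x
  cases q <;> simp [feeds]

theorem eq_msg_or_out_of_mem_taps {r : DFZTerm} {x : DFZVertex} (h : x ∈ taps r) :
    (∃ i, x = .msg i) ∨ ∃ q', x = .out q' := by
  revert x
  cases r <;> simp [taps]

theorem coeffAt_out_mem_span (q : DFZCoded) :
    coeffAt P (.out q) ∈ Submodule.span R {m | ∃ x ∈ feeds q, coeffAt P x = m} := by
  refine P.coeff_mem_of (fun s hs => by cases hs) fun e' he' => ?_
  change network.c2Head e' = .base (.into q) at he'
  cases e' with
  | base e' =>
    obtain ⟨⟨x, y⟩, hxy⟩ := e'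
    obtain rfl : y = .into q := C2Vertex.base.inj he'
    refine Submodule.span_mono ?_ (coeff_base_mem_span P _ (eq_msg_or_out_of_mem_feeds hxy))
    rintro _ rfl
    exact ⟨x, hxy, rfl⟩
  | sw j => exact absurd (C2Vertex.base.inj he') (by rintro ⟨⟩)
  | _ => cases he'

theorem single_demand_mem_span [IsDedekindFiniteMonoid R] (r : DFZTerm) :
    Pi.single (some (demand r)) 1 ∈
      Submodule.span R {m | ∃ x ∈ taps r, coeffAt P x = m} := by
  refine Submodule.span_le.2 ?_
    (TypeIANetwork.single_demand_mem_span P (t := r) (by rintro i ⟨⟩))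
  rintro _ ⟨⟨⟨x, y⟩, hxy⟩, h, rfl⟩
  obtain rfl : y = .term r := h
  refine Submodule.span_mono ?_ (coeff_base_mem_span P _ (eq_msg_or_out_of_mem_taps hxy))
  rintro _ rfl
  exact ⟨x, hxy, rfl⟩

theorem subsingleton_of_linearSolution [IsDedekindFiniteMonoid R]
    (P : network.c2.LinearSolution R) : Subsingleton R := by
  have hq := coeffAt_out_mem_span P
  have hr := single_demand_mem_span P
  have hm : ∀ i, coeffAt P (.msg i) = Pi.single (some i) 1 := fun _ => rfl
  -- From here on only the linear relations among the vectors matter, not the network.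
  generalize coeffAt P = g at hq hr hm
  have hw := hq .ab
  have hy := hq .bc
  have hx := hq .abcF
  have hz := hq .abcF'
  have hp := hq .abc
  have hpab := hq .ab'
  have hpac := hq .ac'
  have hpbc := hq .bc'
  have hq' := hq .cde
  have hqcd := hq .cd
  have hqce := hq .ce
  have hqde := hq .de
  have t1 := hr .c₀
  have t2 := hr .b₀
  have t3 := hr .a₀
  have t4 := hr .c₁
  have t5 := hr .b₁
  have t6 := hr .a₁
  have t7 := hr .c₂
  have t8 := hr .e₂
  have t9 := hr .d₂
  have t10 := hr .last
  clear hq hr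
  simp only [feeds, taps, demand, mem_span_list_cons, mem_span_list_nil, exists_eq_left, hm,
    add_zero, existsAndEq, true_and] at *
  obtain ⟨wa, wb, hw⟩ := hw
  obtain ⟨yb, yc, hy⟩ := hy
  obtain ⟨h₁, h₂, hx⟩ := hx
  obtain ⟨l₁, l₂, hz⟩ := hz
  obtain ⟨pa, pb, pc, hp⟩ := hp
  obtain ⟨ma, mb, hpab⟩ := hpab
  obtain ⟨na, nc, hpac⟩ := hpac
  obtain ⟨kb, kc, hpbc⟩ := hpbc
  obtain ⟨qc, qd, qe, hq'⟩ := hq'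
  obtain ⟨mc', md', hqcd⟩ := hqcd
  obtain ⟨nc', ne', hqce⟩ := hqce
  obtain ⟨kd', ke', hqde⟩ := hqde
  rw [hw, hy] at hz
  rw [hw] at hx
  rw [hz] at t1
  rw [hx, hz] at t2
  rw [hx, hy] at t3
  rw [hp, hpab] at t4
  rw [hp, hpac] at t5
  rw [hp, hpbc] at t6
  rw [hq', hqde] at t7
  rw [hq', hqcd] at t8
  rw [hq', hqce] at t9
  rw [hpab, hpac, hpbc, hqcd, hqce, hqde] at t10
  clear hm hw hy hx hz hp hpab hpac hpbc hq' hqcd hqce hqde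
  obtain ⟨u₁, v₁, t1⟩ := t1
  obtain ⟨u₂, v₂, t2⟩ := t2
  obtain ⟨u₃, v₃, t3⟩ := t3
  obtain ⟨u₄, v₄, t4⟩ := t4
  obtain ⟨u₅, v₅, t5⟩ := t5
  obtain ⟨u₆, v₆, t6⟩ := t6
  obtain ⟨u₇, v₇, t7⟩ := t7
  obtain ⟨u₈, v₈, t8⟩ := t8
  obtain ⟨u₉, v₉, t9⟩ := t9
  obtain ⟨α, β, γ, α', β', γ', t10⟩ := t10
  -- Comparing coefficients of the five messages turns each decoding identity into equations in `R`.
  have coords : ∀ {f f' : Option DFZMsg → R}, f = f' →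
      f' (some .a) = f (some .a) ∧ f' (some .b) = f (some .b) ∧ f' (some .c) = f (some .c) ∧
        f' (some .d) = f (some .d) ∧ f' (some .e) = f (some .e) := by
    rintro f _ rfl
    exact ⟨rfl, rfl, rfl, rfl, rfl⟩
  replace t1 := coords t1
  replace t2 := coords t2
  replace t3 := coords t3
  replace t4 := coords t4
  replace t5 := coords t5
  replace t6 := coords t6
  replace t7 := coords t7
  replace t8 := coords t8
  replace t9 := coords t9
  replace t10 := coords t10
  clear coords
  simp only [Pi.add_apply, Pi.smul_apply, smul_eq_mul, Pi.single_apply, Option.some.injEq,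
    reduceCtorEq, if_true, if_false, mul_one, mul_zero, add_zero, zero_add, true_and,
    and_true] at *
  have two := two_eq_zero_of_fano t1.2.1 t1.2.2 t2.1 t2.2.1 t2.2.2 t3.1 t3.2.1 t3.2.2
  have left := nonFano_combination_eq_zero two t4.1 t4.2.1 t4.2.2 t5.1 t5.2.1 t5.2.2
    t6.1 t6.2.1 t6.2.2 t10.1 t10.2.1
  -- The second non-Fano part has `d`, `e`, `c` in the roles of `a`, `b`, `c`. Since `a`, `b` occur
  -- only in the first part and `d`, `e` only in the second, the cancellations at the last terminal
  -- hold in each part separately.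
  have right := nonFano_combination_eq_zero two t7.2.1 t7.2.2 t7.1 t8.2.1 t8.2.2 t8.1
    t9.2.1 t9.2.2 t9.1 (α := γ') (β := α') (γ := β') (by rw [add_comm]; exact t10.2.2.2.1)
      (by rw [add_comm]; exact t10.2.2.2.2)
  refine subsingleton_of_zero_eq_one ?_
  rw [← t10.2.2.1, ← add_assoc, left, right, add_zero]

end DFZ

theorem DFZ.not_c2_sumLinearSolvable {F : Type*} [Field F] {k : ℕ} (hk : 0 < k) :
    ¬ DFZ.network.c2.SumLinearSolvable F k := by
  rintro ⟨C, hC, hR⟩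
  obtain ⟨P⟩ := C.exists_linearSolution hC hR
  -- For `k > 0` the ring of endomorphisms of `F^k` is nontrivial.
  have : NeZero k := ⟨hk.ne'⟩
  exact not_subsingleton _ (DFZ.subsingleton_of_linearSolution P)

theorem mainTheorem7 :
    DFZ.network.c2.SumSolvable (GaloisField 2 2) ∧
      ∀ (F : Type*) [Field F] [Finite F] (k : ℕ), 0 < k →
        ¬ DFZ.network.c2.SumLinearSolvable F k := by
  refine ⟨DFZ.c2_sumSolvable ?_, fun F _ _ k hk => DFZ.not_c2_sumLinearSolvable hk⟩
  rw [GaloisField.card 2 2 two_ne_zero]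
  norm_num
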